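/- Fix $p\in(0,1)$, let $q=1-p$ and $H=-p\ln p-q\ln q$. Let $\Xi^{(1)},\Xi^{(2)},\dots$ be i.i.d. random infinite strings $\Xi^{(j)}=\xi^{(j)}_1\xi^{(j)}_2\cdots$ over the alphabet $\{0,1\}$, whose letters $\xi^{(j)}_k$ are i.i.d. with $\mathbb P(\xi^{(j)}_k=1)=p$ and $\mathbb P(\xi^{(j)}_k=0)=q$. For $n\ge 1$ consider the trie constructed from the $n$ strings $\Xi^{(1)},\dots,\Xi^{(n)}$: the trie of no strings is empty; the trie of a single string is a root that stores the string; the trie of two or more strings consists of a root, storing no string, whose left and right subtrees are built recursively from the strings with letter $0$ and those with letter $1$, respectively, where at the $k$th level the strings are partitioned according to their $k$th letter. (The strings are almost surely distinct, and then the procedure terminates.) Select one of the $n$ strings, with a non-random index $i_n\in\{1,\dots,n\}$ (for example $i_n=1$), and let the imbalance factor $\Delta_n$ be the number of steps to the right minus the number of steps to the left in the path from the root of the trie to the leaf where the selected string is stored. Then, as $n\to\infty$, $$\Delta_n\sim\mathrm{AsN}\left(\frac{p-q}{H}\ln n,\ \frac{pq\ln^2(pq)}{H^3}\ln n\right),$$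 that is, the variance parameter is positive for all large $n$ and $$\frac{\Delta_n-\frac{p-q}{H}\ln n}{\sqrt{\frac{pq\ln^2(pq)}{H^3}\ln n}}\ \xrightarrow{\ d\ }\ N(0,1).$$ -/

import Mathlib

open MeasureTheory ProbabilityTheory Filter

namespace RandomTrie

/-- Binary trees whose leaves (external nodes) each store one item of `ι`; the first subtree of a
`node` is the left one and the second is the right one. -/
inductive BinTrie (ι : Type*) where
  | empty : BinTrie ι
  | leaf (i : ι) : BinTrie ι
  | node (left right : BinTrie ι) : BinTrie ι

/-- `IsTrie x k S t`: the tree `t` arises from the strings `x i = x i 0, x i 1, …`, `i ∈ S`, by the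
recursive trie procedure, started at level `k` (`false` is the letter 0 and `true` the letter 1).
No strings give the empty tree, a single string is stored in the root, and two or more strings are
distributed according to the letter at position `k`: those with letter 0 go to the left subtree and
those with letter 1 go to the right subtree. -/
inductive IsTrie {ι : Type*} (x : ι → ℕ → Bool) : ℕ → Finset ι → BinTrie ι → Prop
  | empty (k : ℕ) : IsTrie x k ∅ .empty
  | single (k : ℕ) (i : ι) : IsTrie x k {i} (.leaf i)
  | split (k : ℕ) (S : Finset ι) (l r : BinTrie ι) (hS : 2 ≤ S.card)
      (hl : IsTrie x (k + 1) (S.filter fun i => x i k = false) l)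
      (hr : IsTrie x (k + 1) (S.filter fun i => x i k = true) r) :
      IsTrie x k S (.node l r)

/-- The procedure has at most one outcome. -/
theorem IsTrie.unique {ι : Type*} {x : ι → ℕ → Bool} {k : ℕ} {S : Finset ι} {t t' : BinTrie ι}
    (h : IsTrie x k S t) (h' : IsTrie x k S t') : t = t' := by
  induction h generalizing t' with
  | empty k =>
    generalize hE : (∅ : Finset ι) = E at h'
    cases h' with
    | empty => rfl
    | single _ i => exact absurd hE.symm (Finset.singleton_ne_empty i)
    | split _ _ l r hS => subst hE; simp at hS
  | single k i =>
    generalize hE : ({i} : Finset ι) = E at h'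
    cases h' with
    | empty => exact absurd hE (Finset.singleton_ne_empty i)
    | single _ j => rw [Finset.singleton_injective hE]
    | split _ _ l r hS => subst hE; simp at hS
  | split k S l r hS hl hr ihl ihr =>
    cases h' with
    | empty => simp at hS
    | single _ j => simp at hS
    | split _ _ l' r' _ hl' hr' => rw [ihl hl', ihr hr']

/-- The procedure terminates if the strings are distinct. -/
theorem exists_isTrie {ι : Type*} {x : ι → ℕ → Bool} {S : Finset ι}
    (h : Set.InjOn x (S : Set ι)) : ∃ t, IsTrie x 0 S t := by
  classical
  -- all pairs of strings in `S` are separated before some common level `m`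
  have hsep : ∃ m : ℕ, ∀ i ∈ S, ∀ j ∈ S, (∀ a < m, x i a = x j a) → i = j := by
    have h1 : ∀ i j, ∃ m : ℕ, i ∈ S → j ∈ S → (∀ a < m, x i a = x j a) → i = j := by
      intro i j
      by_cases hij : x i = x j
      · exact ⟨0, fun hi hj _ => h hi hj hij⟩
      · obtain ⟨a, ha⟩ := Function.ne_iff.mp hij
        exact ⟨a + 1, fun _ _ hh => absurd (hh a (Nat.lt_succ_self a)) ha⟩
    choose f hf using h1
    refine ⟨S.sup fun i => S.sup fun j => f i j, fun i hi j hj hh => hf i j hi hj fun a ha => ?_⟩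
    exact hh a (ha.trans_le ((Finset.le_sup (f := fun j => f i j) hj).trans
      (Finset.le_sup (f := fun i => S.sup fun j => f i j) hi)))
  obtain ⟨m, hm⟩ := hsep
  have key : ∀ d k : ℕ, d + k = m → ∀ T ⊆ S, (∀ i ∈ T, ∀ j ∈ T, ∀ a < k, x i a = x j a) →
      ∃ t, IsTrie x k T t := by
    intro d
    induction d with
    | zero =>
      intro k hk T hT hag
      have hk' : k = m := by omega
      subst hk'
      rcases T.eq_empty_or_nonempty with rfl | ⟨i, hi⟩
      · exact ⟨_, .empty _⟩
      · have : T = {i} := Finset.eq_singleton_iff_unique_mem.mpr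
          ⟨hi, fun j hj => hm j (hT hj) i (hT hi) (hag j hj i hi)⟩
        subst this
        exact ⟨_, .single _ _⟩
    | succ d ih =>
      intro k hk T hT hag
      rcases Nat.lt_or_ge T.card 2 with hc | hc
      · rcases T.eq_empty_or_nonempty with rfl | hne
        · exact ⟨_, .empty _⟩
        · obtain ⟨i, rfl⟩ := Finset.card_eq_one.mp (by have := hne.card_pos; omega : T.card = 1)
          exact ⟨_, .single _ _⟩
      · have sub : ∀ b : Bool, ∃ t, IsTrie x (k + 1) (T.filter fun i => x i k = b) t := by
          intro b
          refine ih (k + 1) (by omega) _ ((Finset.filter_subset _ _).trans hT) ?_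
          intro i hi j hj a ha
          rw [Finset.mem_filter] at hi hj
          rcases Nat.lt_succ_iff_lt_or_eq.mp ha with ha | rfl
          · exact hag i hi.1 j hj.1 a ha
          · rw [hi.2, hj.2]
        obtain ⟨l, hl⟩ := sub false
        obtain ⟨r, hr⟩ := sub true
        exact ⟨_, .split k T l r hc hl hr⟩
  exact key m 0 (by omega) S subset_rfl (by intro i _ j _ a ha; omega)

open Classical in
/-- The trie constructed from the strings `x i`, `i ∈ S`. It exists and is unique when these strings
are distinct; the value `empty` is used otherwise. -/
noncomputable def trie {ι : Type*} (x : ι → ℕ → Bool) (S : Finset ι) : BinTrie ι :=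
  if h : ∃ t, IsTrie x 0 S t then h.choose else .empty

/-- The path from the root to the leaf that stores `i` (if there is one): `false` is a step to the
left and `true` is a step to the right. -/
def BinTrie.pathTo {ι : Type*} [DecidableEq ι] : BinTrie ι → ι → Option (List Bool)
  | .empty, _ => none
  | .leaf j, i => if i = j then some [] else none
  | .node l r, i =>
    ((l.pathTo i).map (List.cons false)).or ((r.pathTo i).map (List.cons true))

/-- The number of steps to the right minus the number of steps to the left in the path from the root
to the leaf that stores `i`. -/
def BinTrie.imbalance {ι : Type*} [DecidableEq ι] (t : BinTrie ι) (i : ι) : ℤ :=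
  match t.pathTo i with
  | some w => (w.count true : ℤ) - (w.count false : ℤ)
  | none => 0

/-- `Z n ∼ AsN(m n, v n)`: the variances `v n` are eventually positive, and `(Z n - m n) / √(v n)`
converges in distribution to the standard normal law. -/
def AsN {Ω : Type*} [MeasurableSpace Ω] (P : Measure Ω) [IsProbabilityMeasure P]
    (Z : ℕ → Ω → ℝ) (m v : ℕ → ℝ) : Prop :=
  (∀ᶠ n in atTop, 0 < v n) ∧
    TendstoInDistribution (fun n ω => (Z n ω - m n) / √(v n)) atTop (id : ℝ → ℝ)
      (fun _ => P) (gaussianReal 0 1)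

end RandomTrie

/-! Give each letter the cost minus the logarithm of its probability, so that a prefix of total cost
`W` has probability `exp (-W)`. Another of the `n` strings has the same prefix with high probability
if `n * exp (-W)` is large, and with low probability if it is small. Hence the leaf of the selected
string lies at the depth `D` where the accumulated cost of its letters passes `log n`, up to an
error negligible against `√(log n)` (`real_sharesPrefix_and_le`, `real_not_sharesPrefix_and_le`).

The imbalance is the sum of the ±1 steps of the first `D` letters. Split each step as `drift p *
cost + residual`, with `drift p` chosen to make the residual centred. The cost part sums to about
`drift p * log n`, with no Gaussian fluctuation, so all randomness is in the residuals. Since `D` is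
close to the deterministic time `m = ⌊log n / H⌋`, the residual sum up to `D` may be replaced by the
one up to `m`, with an error controlled by Hoeffding bounds and a union over depths
(`abs_sum_step_sub_le`, `real_lt_abs_imbalance_sub_le`). The central limit theorem for the first `m`
residuals and Slutsky's theorem finish the proof. The variance is `m` times that of one residual,
computed in `mean_residual_sq`. -/

namespace RandomTrie

/-! ### The leaf depth in terms of shared prefixes. -/

section Deterministic

variable {ι : Type*}

/-- Some string `x j`, `j ∈ S`, other than `x i` has the same first `d` letters as `x i`. -/
def SharesPrefix (x : ι → ℕ → Bool) (S : Finset ι) (i : ι) (d : ℕ) : Prop :=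
  ∃ j ∈ S, j ≠ i ∧ ∀ a < d, x j a = x i a

theorem IsTrie.pathTo_eq_none [DecidableEq ι] {x : ι → ℕ → Bool} {k : ℕ} {S : Finset ι}
    {t : BinTrie ι} (h : IsTrie x k S t) {i : ι} (hi : i ∉ S) : t.pathTo i = none := by
  induction h with
  | empty k => rfl
  | single k j => simpa [BinTrie.pathTo, eq_comm] using hi
  | split k S l r hS hl hr ihl ihr =>
    simp [BinTrie.pathTo, ihl (by simp [hi]), ihr (by simp [hi])]

/-- The path to a leaf spells the letters of its string and goes on exactly as long as some other
string agrees with them. In the induction, descending one level removes the first letter and the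
strings that differ there. -/
theorem IsTrie.exists_pathTo [DecidableEq ι] {x : ι → ℕ → Bool} {k : ℕ} {S : Finset ι}
    {t : BinTrie ι} (h : IsTrie x k S t) {i : ι} (hi : i ∈ S) :
    ∃ d, t.pathTo i = some ((List.range d).map fun a => x i (k + a)) ∧
      ∀ e, SharesPrefix (fun j a => x j (k + a)) S i e ↔ e < d := by
  induction h with
  | empty k => simp at hi
  | single k j =>
    obtain rfl := Finset.mem_singleton.mp hi
    exact ⟨0, by simp [BinTrie.pathTo], fun e => by simp [SharesPrefix]⟩
  | split k S l r hS hl hr ihl ihr =>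
    have key : ∀ {s : BinTrie ι} {b : Bool}, x i k = b →
        (∃ d, s.pathTo i = some ((List.range d).map fun a => x i (k + 1 + a)) ∧
          ∀ e, SharesPrefix (fun j a => x j (k + 1 + a)) (S.filter fun j => x j k = b) i e
            ↔ e < d) →
        ∃ d, (s.pathTo i).map (List.cons b) = some ((List.range d).map fun a => x i (k + a)) ∧
          ∀ e, SharesPrefix (fun j a => x j (k + a)) S i e ↔ e < d := by
      rintro s b rfl ⟨d, hd, hs⟩
      refine ⟨d + 1, ?_, fun e => ?_⟩
      · rw [hd, List.range_succ_eq_map]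
        simp [Function.comp_def, add_assoc, add_comm 1]
      · cases e with
        | zero =>
          -- The empty prefix is shared with any other string, and a split node has one.
          obtain ⟨j, hj, hji⟩ := Finset.exists_mem_ne (by omega : 1 < S.card) i
          simpa [SharesPrefix] using ⟨j, hj, hji⟩
        | succ e =>
          rw [add_lt_add_iff_right, ← hs e]
          refine exists_congr fun j => ?_
          rw [Finset.mem_filter, Nat.forall_lt_succ_left']
          simp only [add_zero, add_assoc, add_comm 1]
          tauto
    cases hb : x i k with
    | false =>
      obtain ⟨d, hd, hs⟩ := key hb (ihl (by simp [hi, hb]))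
      exact ⟨d, by simp [BinTrie.pathTo, hr.pathTo_eq_none (i := i) (by simp [hb]), hd], hs⟩
    | true =>
      obtain ⟨d, hd, hs⟩ := key hb (ihr (by simp [hi, hb]))
      exact ⟨d, by simp [BinTrie.pathTo, hl.pathTo_eq_none (i := i) (by simp [hb]), hd], hs⟩

/-- The letter 1 is a step to the right and the letter 0 is a step to the left. -/
def step (b : Bool) : ℝ := if b then 1 else -1

theorem count_true_sub_count_false (w : ℕ → Bool) (d : ℕ) :
    ((((List.range d).map w).count true : ℤ) - (((List.range d).map w).count false : ℤ) : ℝ) =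
      ∑ k ∈ Finset.range d, step (w k) := by
  induction d with
  | zero => simp
  | succ d ih =>
    rw [List.range_succ, Finset.sum_range_succ, ← ih]
    cases h : w d <;> simp [step, h] <;> ring

theorem exists_imbalance_trie [DecidableEq ι] {x : ι → ℕ → Bool} {S : Finset ι}
    (hx : Set.InjOn x (S : Set ι)) {i : ι} (hi : i ∈ S) :
    ∃ d, ((trie x S).imbalance i : ℝ) = ∑ k ∈ Finset.range d, step (x i k) ∧
      ∀ e, SharesPrefix x S i e ↔ e < d := by
  have hex := exists_isTrie hx
  have ht : IsTrie x 0 S (trie x S) := by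
    rw [trie, dif_pos hex]
    exact hex.choose_spec
  obtain ⟨d, hd, hs⟩ := ht.exists_pathTo hi
  simp only [zero_add] at hd hs
  refine ⟨d, ?_, hs⟩
  rw [BinTrie.imbalance, hd, ← count_true_sub_count_false]
  push_cast
  rfl

end Deterministic

end RandomTrie

namespace RandomTrie

/-! ### Probability that a prefix is shared, given its cost. -/

section Prefix

variable {Ω : Type*} [MeasurableSpace Ω] {P : Measure Ω} {p : ℝ} {ξ : ℕ → ℕ → Ω → Bool}

/-- The probability of a letter. -/
noncomputable def letterProb (p : ℝ) (b : Bool) : ℝ := if b then p else 1 - p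

/-- The logarithmic cost of a letter. -/
noncomputable def cost (p : ℝ) (b : Bool) : ℝ := -Real.log (letterProb p b)

theorem letterProb_pos (hp0 : 0 < p) (hp1 : p < 1) (b : Bool) : 0 < letterProb p b := by
  cases b <;> simp [letterProb, hp0, hp1]

theorem exp_neg_sum_cost (hp0 : 0 < p) (hp1 : p < 1) {κ : Type*} (s : Finset κ) (u : κ → Bool) :
    Real.exp (-∑ k ∈ s, cost p (u k)) = ∏ k ∈ s, letterProb p (u k) := by
  rw [← Finset.sum_neg_distrib, Real.exp_sum]
  exact Finset.prod_congr rfl fun k _ => by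
    rw [cost, neg_neg, Real.exp_log (letterProb_pos hp0 hp1 _)]

/-- Currying turns the product law on `ℕ × ℕ` into a product of the laws of the rows, so whole
strings are independent. -/
theorem iIndepFun_rows [IsProbabilityMeasure P] (hmeas : ∀ j k, Measurable (ξ j k))
    (hindep : iIndepFun (fun (a : ℕ × ℕ) => ξ a.1 a.2) P) :
    iIndepFun (fun j ω k => ξ j k ω) P := by
  have hrow : ∀ j, iIndepFun (ξ j) P := fun j =>
    hindep.precomp (g := fun k => (j, k)) (fun _ _ h => (Prod.mk.inj h).2)
  have : ∀ j k, IsProbabilityMeasure (P.map (ξ j k)) := fun j k =>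
    Measure.isProbabilityMeasure_map (hmeas j k).aemeasurable
  rw [iIndepFun_iff_map_fun_eq_infinitePi_map (by fun_prop)]
  have h1 : P.map (fun ω (a : ℕ × ℕ) => ξ a.1 a.2 ω) =
      Measure.infinitePi (fun a : ℕ × ℕ => P.map (ξ a.1 a.2)) :=
    (iIndepFun_iff_map_fun_eq_infinitePi_map (fun a : ℕ × ℕ => hmeas a.1 a.2)).1 hindep
  have h2 : (MeasurableEquiv.curry ℕ ℕ Bool) ∘ (fun ω (a : ℕ × ℕ) => ξ a.1 a.2 ω) =
      fun ω j k => ξ j k ω := rfl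
  rw [← h2, ← Measure.map_map (by fun_prop) (by fun_prop), h1,
    Measure.infinitePi_map_curry (fun j k => P.map (ξ j k))]
  congr 1
  ext1 j
  exact ((iIndepFun_iff_map_fun_eq_infinitePi_map (hmeas j)).1 (hrow j)).symm

theorem real_letter [IsProbabilityMeasure P] (hmeas : ∀ j k, Measurable (ξ j k))
    (hlaw : ∀ j k, P.real {ω | ξ j k ω = true} = p) (j k : ℕ) (b : Bool) :
    P.real {ω | ξ j k ω = b} = letterProb p b := by
  cases b with
  | true => exact hlaw j k
  | false =>
    have : {ω | ξ j k ω = false} = {ω | ξ j k ω = true}ᶜ := by ext; simp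
    have hm : MeasurableSet {ω | ξ j k ω = true} := hmeas j k (measurableSet_singleton true)
    rw [this, probReal_compl_eq_one_sub hm, hlaw]
    rfl

/-- The strings whose first letters are those of `u`. -/
def cylinder {d : ℕ} (u : Fin d → Bool) : Set (ℕ → Bool) := {x | ∀ k : Fin d, x k = u k}

theorem measurableSet_cylinder {d : ℕ} (u : Fin d → Bool) : MeasurableSet (cylinder u) := by
  have : cylinder u = ⋂ k : Fin d, (fun x : ℕ → Bool => x k) ⁻¹' {u k} := by
    ext x; simp [cylinder]
  rw [this]
  exact MeasurableSet.iInter fun k => measurable_pi_apply (k : ℕ) (measurableSet_singleton (u k))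

theorem real_row_mem_cylinder [IsProbabilityMeasure P] (hp0 : 0 < p) (hp1 : p < 1)
    (hmeas : ∀ j k, Measurable (ξ j k))
    (hindep : iIndepFun (fun (a : ℕ × ℕ) => ξ a.1 a.2) P)
    (hlaw : ∀ j k, P.real {ω | ξ j k ω = true} = p) (j : ℕ) {d : ℕ} (u : Fin d → Bool) :
    P.real ((fun ω k => ξ j k ω) ⁻¹' cylinder u) = Real.exp (-∑ k, cost p (u k)) := by
  have hrow : iIndepFun (fun k : Fin d => ξ j k) P :=
    hindep.precomp (g := fun k : Fin d => (j, (k : ℕ)))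
      (fun _ _ h => Fin.ext (Prod.mk.inj h).2)
  have h := hrow.measure_inter_preimage_eq_mul Finset.univ (sets := fun k => {u k})
    (fun k _ => measurableSet_singleton _)
  have hset : ((fun ω k => ξ j k ω) ⁻¹' cylinder u) =
      ⋂ k ∈ Finset.univ, (fun k : Fin d => ξ j k) k ⁻¹' {u k} := by
    ext ω; simp [cylinder]
  rw [hset, measureReal_def, h, ENNReal.toReal_prod, exp_neg_sum_cost hp0 hp1]
  exact Finset.prod_congr rfl fun k _ => real_letter hmeas hlaw j k (u k)

/-- A bound on the conditional probabilities given the prefix of a string bounds the probability. -/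
theorem real_le_of_forall_cylinder [IsProbabilityMeasure P] (hmeas : ∀ j k, Measurable (ξ j k))
    (i d : ℕ) (E : Set Ω) (c : ℝ)
    (h : ∀ u : Fin d → Bool, P.real (E ∩ ((fun ω k => ξ i k ω) ⁻¹' cylinder u)) ≤
      c * P.real ((fun ω k => ξ i k ω) ⁻¹' cylinder u)) : P.real E ≤ c := by
  have hcov : E ⊆ ⋃ u ∈ (Finset.univ : Finset (Fin d → Bool)),
      E ∩ ((fun ω k => ξ i k ω) ⁻¹' cylinder u) := by
    intro ω hω
    simp only [Set.mem_iUnion]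
    exact ⟨fun k => ξ i k ω, Finset.mem_univ _, hω, fun k => rfl⟩
  have hmeasA : ∀ u : Fin d → Bool, MeasurableSet ((fun ω k => ξ i k ω) ⁻¹' cylinder u) :=
    fun u => (measurable_pi_lambda _ (hmeas i)) (measurableSet_cylinder u)
  have htot : ∑ u : Fin d → Bool, P.real ((fun ω k => ξ i k ω) ⁻¹' cylinder u) = 1 := by
    rw [← measureReal_biUnion_finset]
    · convert probReal_univ (μ := P) using 2
      refine Set.eq_univ_of_forall fun ω => ?_
      simp only [Set.mem_iUnion]
      exact ⟨fun k => ξ i k ω, Finset.mem_univ _, fun k => rfl⟩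
    · intro u _ v _ huv
      refine Set.disjoint_left.2 fun ω hu hv => huv (funext fun k => ?_)
      exact (hu k).symm.trans (hv k)
    · exact fun u _ => hmeasA u
  calc P.real E ≤ P.real (⋃ u ∈ (Finset.univ : Finset (Fin d → Bool)),
        E ∩ ((fun ω k => ξ i k ω) ⁻¹' cylinder u)) := measureReal_mono hcov (measure_ne_top _ _)
    _ ≤ ∑ u : Fin d → Bool, P.real (E ∩ ((fun ω k => ξ i k ω) ⁻¹' cylinder u)) :=
        measureReal_biUnion_finset_le _ _
    _ ≤ ∑ u : Fin d → Bool, c * P.real ((fun ω k => ξ i k ω) ⁻¹' cylinder u) :=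
        Finset.sum_le_sum fun u _ => h u
    _ = c := by rw [← Finset.mul_sum, htot, mul_one]

theorem sum_cost_eq_of_mem_cylinder {d : ℕ} {u : Fin d → Bool} {x : ℕ → Bool}
    (hx : x ∈ cylinder u) : ∑ k ∈ Finset.range d, cost p (x k) = ∑ k, cost p (u k) := by
  rw [← Fin.sum_univ_eq_sum_range (fun k => cost p (x k))]
  exact Finset.sum_congr rfl fun k _ => by rw [hx k]

/-- Union bound: given the first `d` letters of string `i`, each other string repeats them with
probability `exp (-cost) ≤ exp (-r)`. -/
theorem real_sharesPrefix_and_le [IsProbabilityMeasure P] (hp0 : 0 < p) (hp1 : p < 1)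
    (hmeas : ∀ j k, Measurable (ξ j k))
    (hindep : iIndepFun (fun (a : ℕ × ℕ) => ξ a.1 a.2) P)
    (hlaw : ∀ j k, P.real {ω | ξ j k ω = true} = p) (S : Finset ℕ) (i d : ℕ) (r : ℝ) :
    P.real {ω | SharesPrefix (fun j k => ξ j k ω) S i d ∧
      r ≤ ∑ k ∈ Finset.range d, cost p (ξ i k ω)} ≤ S.card * Real.exp (-r) := by
  refine real_le_of_forall_cylinder hmeas i d _ _ fun u => ?_
  set A : ℕ → Set Ω := fun j => ((fun ω k => ξ j k ω) ⁻¹' cylinder u) with hA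
  have hpA : ∀ j, P.real (A j) = Real.exp (-∑ k, cost p (u k)) :=
    fun j => real_row_mem_cylinder hp0 hp1 hmeas hindep hlaw j u
  -- On the cylinder of `u` the cost is a constant, so its constraint either holds throughout or
  -- makes the event empty.
  by_cases hr : r ≤ ∑ k, cost p (u k)
  · have hsub : {ω | SharesPrefix (fun j k => ξ j k ω) S i d ∧
        r ≤ ∑ k ∈ Finset.range d, cost p (ξ i k ω)} ∩ A i ⊆
        ⋃ j ∈ S.erase i, (A i ∩ A j) := by
      rintro ω ⟨⟨⟨j, hj, hji, hag⟩, -⟩, hi⟩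
      simp only [Set.mem_iUnion]
      exact ⟨j, Finset.mem_erase.2 ⟨hji, hj⟩, hi, fun k => (hag k k.2).trans (hi k)⟩
    have hpair : ∀ j ∈ S.erase i, P.real (A i ∩ A j) ≤ Real.exp (-r) * P.real (A i) := by
      intro j hj
      have hind := (iIndepFun_rows hmeas hindep).indepFun (Finset.ne_of_mem_erase hj).symm
      have := hind.measure_inter_preimage_eq_mul _ _ (measurableSet_cylinder u)
        (measurableSet_cylinder u)
      have h2 : P.real (A i ∩ A j) = P.real (A i) * P.real (A j) := by
        rw [measureReal_def, measureReal_def, measureReal_def, ← ENNReal.toReal_mul]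
        exact congrArg _ this
      rw [h2, mul_comm, hpA j]
      gcongr
    calc P.real _ ≤ P.real (⋃ j ∈ S.erase i, (A i ∩ A j)) :=
          measureReal_mono hsub (measure_ne_top _ _)
      _ ≤ ∑ j ∈ S.erase i, P.real (A i ∩ A j) := measureReal_biUnion_finset_le _ _
      _ ≤ ∑ j ∈ S.erase i, Real.exp (-r) * P.real (A i) := Finset.sum_le_sum hpair
      _ = (S.erase i).card * (Real.exp (-r) * P.real (A i)) := by simp
      _ ≤ S.card * (Real.exp (-r) * P.real (A i)) := by
        gcongr
        exact Finset.erase_subset _ _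
      _ = _ := by ring
  · have hempty : {ω | SharesPrefix (fun j k => ξ j k ω) S i d ∧
        r ≤ ∑ k ∈ Finset.range d, cost p (ξ i k ω)} ∩ A i = ∅ := by
      refine Set.eq_empty_of_forall_notMem fun ω hω => hr ?_
      rw [← sum_cost_eq_of_mem_cylinder (x := fun k => ξ i k ω) hω.2]
      exact hω.1.2
    rw [hempty, measureReal_empty]
    positivity

/-- Given the prefix, the other `S.card - 1` strings avoid it independently, each with probability
at most `1 - exp (-r) ≤ exp (-exp (-r))`. -/
theorem real_not_sharesPrefix_and_le [IsProbabilityMeasure P] (hp0 : 0 < p) (hp1 : p < 1)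
    (hmeas : ∀ j k, Measurable (ξ j k))
    (hindep : iIndepFun (fun (a : ℕ × ℕ) => ξ a.1 a.2) P)
    (hlaw : ∀ j k, P.real {ω | ξ j k ω = true} = p) (S : Finset ℕ) {i : ℕ} (hi : i ∈ S) (d : ℕ)
    (r : ℝ) :
    P.real {ω | ¬ SharesPrefix (fun j k => ξ j k ω) S i d ∧
      ∑ k ∈ Finset.range d, cost p (ξ i k ω) ≤ r} ≤
      Real.exp (-((S.card - 1 : ℝ) * Real.exp (-r))) := by
  refine real_le_of_forall_cylinder hmeas i d _ _ fun u => ?_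
  set A : ℕ → Set Ω := fun j => ((fun ω k => ξ j k ω) ⁻¹' cylinder u) with hA
  have hAmeas : ∀ j, MeasurableSet (A j) :=
    fun j => (measurable_pi_lambda _ (hmeas j)) (measurableSet_cylinder u)
  have hpA : ∀ j, P.real (A j) = Real.exp (-∑ k, cost p (u k)) :=
    fun j => real_row_mem_cylinder hp0 hp1 hmeas hindep hlaw j u
  by_cases hr : ∑ k, cost p (u k) ≤ r
  · let B : ℕ → Set (ℕ → Bool) := fun j => if j = i then cylinder u else (cylinder u)ᶜ
    have hB : ∀ j, MeasurableSet (B j) := fun j => by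
      by_cases h : j = i
      · simpa [B, h] using measurableSet_cylinder u
      · simpa [B, h] using (measurableSet_cylinder u).compl
    have hsub : {ω | ¬ SharesPrefix (fun j k => ξ j k ω) S i d ∧
        ∑ k ∈ Finset.range d, cost p (ξ i k ω) ≤ r} ∩ A i ⊆
        ⋂ j ∈ S, (fun ω k => ξ j k ω) ⁻¹' B j := by
      rintro ω ⟨⟨hns, -⟩, hiA⟩
      simp only [Set.mem_iInter]
      intro j hj
      by_cases h : j = i
      · subst h
        simp only [B, if_true]
        exact hiA
      · have : (fun k => ξ j k ω) ∉ cylinder u := fun hjA =>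
          hns ⟨j, hj, h, fun a ha => (hjA ⟨a, ha⟩).trans (hiA ⟨a, ha⟩).symm⟩
        simpa [B, h] using this
    have hprod : P.real (⋂ j ∈ S, (fun ω k => ξ j k ω) ⁻¹' B j) =
        P.real (A i) * (1 - Real.exp (-∑ k, cost p (u k))) ^ (S.card - 1) := by
      rw [measureReal_def, (iIndepFun_rows hmeas hindep).measure_inter_preimage_eq_mul S
        (fun j _ => hB j), ENNReal.toReal_prod, ← Finset.mul_prod_erase S _ hi]
      congr 1
      · simp only [B, if_true]
        rfl
      · rw [← Finset.card_erase_of_mem hi]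
        refine Finset.prod_eq_pow_card fun j hj => ?_
        have : (fun ω k => ξ j k ω) ⁻¹' B j = (A j)ᶜ := by
          simp only [B, if_neg (Finset.ne_of_mem_erase hj)]
          rfl
        rw [this, ← measureReal_def, probReal_compl_eq_one_sub (hAmeas j), hpA]
    have hle : (1 - Real.exp (-∑ k, cost p (u k))) ^ (S.card - 1) ≤
        Real.exp (-((S.card - 1 : ℝ) * Real.exp (-r))) := by
      have h1 : (0 : ℝ) ≤ 1 - Real.exp (-∑ k, cost p (u k)) := by
        rw [← hpA i, sub_nonneg]
        exact measureReal_le_one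
      have h2 : 1 - Real.exp (-∑ k, cost p (u k)) ≤ Real.exp (-Real.exp (-r)) := by
        have h3 : Real.exp (-r) ≤ Real.exp (-∑ k, cost p (u k)) := by gcongr
        have h4 := Real.add_one_le_exp (-Real.exp (-r))
        linarith
      calc _ ≤ Real.exp (-Real.exp (-r)) ^ (S.card - 1) := by gcongr
        _ = _ := by
          rw [← Real.exp_nat_mul, Nat.cast_sub (Finset.card_pos.2 ⟨i, hi⟩)]
          push_cast
          ring_nf
    calc P.real _ ≤ _ := measureReal_mono hsub (measure_ne_top _ _)
      _ = _ := hprod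
      _ ≤ P.real (A i) * Real.exp (-((S.card - 1 : ℝ) * Real.exp (-r))) := by gcongr
      _ = _ := mul_comm _ _
  · have hempty : {ω | ¬ SharesPrefix (fun j k => ξ j k ω) S i d ∧
        ∑ k ∈ Finset.range d, cost p (ξ i k ω) ≤ r} ∩ A i = ∅ := by
      refine Set.eq_empty_of_forall_notMem fun ω hω => hr ?_
      rw [← sum_cost_eq_of_mem_cylinder (x := fun k => ξ i k ω) hω.2]
      exact hω.1.2
    rw [hempty, measureReal_empty]
    positivity

end Prefix

end RandomTrie

namespace RandomTrie

/-! ### Distinctness, concentration and the central limit theorem for letter sums. -/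

section Sums

variable {Ω : Type*} [MeasurableSpace Ω] {P : Measure Ω} {p : ℝ} {ξ : ℕ → ℕ → Ω → Bool}

theorem cost_pos (hp0 : 0 < p) (hp1 : p < 1) (b : Bool) : 0 < cost p b := by
  rw [cost, neg_pos]
  refine Real.log_neg (letterProb_pos hp0 hp1 b) ?_
  cases b <;> simp [letterProb, hp0, hp1]

/-- The least cost of a letter. -/
noncomputable def minCost (p : ℝ) : ℝ := min (cost p true) (cost p false)

theorem minCost_pos (hp0 : 0 < p) (hp1 : p < 1) : 0 < minCost p :=
  lt_min (cost_pos hp0 hp1 _) (cost_pos hp0 hp1 _)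

theorem minCost_le (b : Bool) : minCost p ≤ cost p b := by
  cases b
  · exact min_le_right _ _
  · exact min_le_left _ _

theorem card_mul_minCost_le (s : Finset ℕ) (x : ℕ → Bool) :
    s.card * minCost p ≤ ∑ k ∈ s, cost p (x k) := by
  rw [← nsmul_eq_mul]
  exact Finset.card_nsmul_le_sum _ _ _ fun k _ => minCost_le _

/-- Two equal strings share prefixes of every length `d`, whose cost is at least `d * minCost p`;
the union bound for the pair tends to 0. -/
theorem ae_injective_rows [IsProbabilityMeasure P] (hp0 : 0 < p) (hp1 : p < 1)
    (hmeas : ∀ j k, Measurable (ξ j k))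
    (hindep : iIndepFun (fun (a : ℕ × ℕ) => ξ a.1 a.2) P)
    (hlaw : ∀ j k, P.real {ω | ξ j k ω = true} = p) :
    ∀ᵐ ω ∂P, Function.Injective fun j k => ξ j k ω := by
  have key : ∀ i j : ℕ, i ≠ j → ∀ᵐ ω ∂P, (fun k => ξ i k ω) ≠ fun k => ξ j k ω := by
    intro i j hij
    rw [ae_iff]
    set E : Set Ω := {ω | ¬ (fun k => ξ i k ω) ≠ fun k => ξ j k ω} with hE
    have hle : ∀ d : ℕ, P.real E ≤ ({i, j} : Finset ℕ).card * Real.exp (-(d * minCost p)) := by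
      intro d
      refine le_trans (measureReal_mono ?_ (measure_ne_top _ _))
        (real_sharesPrefix_and_le hp0 hp1 hmeas hindep hlaw {i, j} i d (d * minCost p))
      intro ω hω
      have hω' : (fun k => ξ i k ω) = fun k => ξ j k ω := not_not.1 hω
      refine ⟨⟨j, by simp, hij.symm, fun a _ => (congrFun hω' a).symm⟩, ?_⟩
      simpa using card_mul_minCost_le (p := p) (Finset.range d) fun k => ξ i k ω
    have hlim : Tendsto (fun d : ℕ => (({i, j} : Finset ℕ).card : ℝ) *
        Real.exp (-(d * minCost p))) atTop (nhds ((({i, j} : Finset ℕ).card : ℝ) * 0)) := by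
      refine Tendsto.const_mul _ (Real.tendsto_exp_neg_atTop_nhds_zero.comp ?_)
      exact tendsto_natCast_atTop_atTop.atTop_mul_const (minCost_pos hp0 hp1)
    rw [mul_zero] at hlim
    have h0 : P.real E = 0 := le_antisymm (ge_of_tendsto' hlim hle) measureReal_nonneg
    rwa [measureReal_eq_zero_iff] at h0
  have hall : ∀ᵐ ω ∂P, ∀ i j : ℕ, i ≠ j → (fun k => ξ i k ω) ≠ fun k => ξ j k ω := by
    simp only [ae_all_iff]
    exact fun i j hij => key i j hij
  filter_upwards [hall] with ω hω i j hij
  by_contra hne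
  exact hω i j hne hij

theorem integral_letter [IsProbabilityMeasure P] (hmeas : ∀ j k, Measurable (ξ j k))
    (hlaw : ∀ j k, P.real {ω | ξ j k ω = true} = p) (f : Bool → ℝ) (j k : ℕ) :
    ∫ ω, f (ξ j k ω) ∂P = p * f true + (1 - p) * f false := by
  have := Measure.isProbabilityMeasure_map (μ := P) (hmeas j k).aemeasurable
  have h : ∀ b, (P.map (ξ j k)).real {b} = letterProb p b := fun b => by
    rw [map_measureReal_apply (hmeas j k) (measurableSet_singleton b),
      ← real_letter hmeas hlaw j k b]
    rfl
  rw [← integral_map (hmeas j k).aemeasurable (f := f) (by fun_prop),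
    integral_fintype (by simp)]
  simp [h, letterProb]

theorem iIndepFun_row (hindep : iIndepFun (fun (a : ℕ × ℕ) => ξ a.1 a.2) P) (j : ℕ) :
    iIndepFun (ξ j) P :=
  hindep.precomp (g := fun k => (j, k)) (fun _ _ h => (Prod.mk.inj h).2)

/-- Hoeffding's inequality for `f` and `-f`. Using `w` in place of `s.card` makes the bound uniform
over all short index sets. -/
theorem real_le_abs_sum_le [IsProbabilityMeasure P] (hmeas : ∀ j k, Measurable (ξ j k))
    (hindep : iIndepFun (fun (a : ℕ × ℕ) => ξ a.1 a.2) P)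
    (hlaw : ∀ j k, P.real {ω | ξ j k ω = true} = p) {f : Bool → ℝ} {M : ℝ} (hM : 0 < M)
    (hf : ∀ b, |f b| ≤ M) (hf0 : p * f true + (1 - p) * f false = 0) (j : ℕ) (s : Finset ℕ)
    {w : ℝ} (hw : 0 < w) (hs : s.card ≤ w) {ε : ℝ} (hε : 0 < ε) :
    P.real {ω | ε ≤ |∑ k ∈ s, f (ξ j k ω)|} ≤ 2 * Real.exp (-(ε ^ 2 / (2 * w * M ^ 2))) := by
  rcases s.eq_empty_or_nonempty with rfl | hne
  · have : {ω : Ω | ε ≤ |∑ k ∈ (∅ : Finset ℕ), f (ξ j k ω)|} = ∅ := by ext; simp [hε]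
    rw [this, measureReal_empty]
    positivity
  have one : ∀ g : Bool → ℝ, (∀ b, |g b| ≤ M) → p * g true + (1 - p) * g false = 0 →
      P.real {ω | ε ≤ ∑ k ∈ s, g (ξ j k ω)} ≤ Real.exp (-(ε ^ 2 / (2 * w * M ^ 2))) := by
    intro g hg hg0
    have hind : iIndepFun (fun k ω => g (ξ j k ω)) P :=
      (iIndepFun_row hindep j).comp (fun _ => g) (fun _ => by fun_prop)
    have hsub : ∀ k ∈ s, HasSubgaussianMGF (fun ω => g (ξ j k ω)) ((‖M - -M‖₊ / 2) ^ 2) P :=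
      fun k _ => hasSubgaussianMGF_of_mem_Icc_of_integral_eq_zero
        ((measurable_from_top (f := g)).comp (hmeas j k)).aemeasurable
        (ae_of_all _ fun ω => abs_le.1 (hg _)) (by rw [integral_letter hmeas hlaw, hg0])
    have h := HasSubgaussianMGF.measure_sum_ge_le_of_iIndepFun hind hsub hε.le
    refine h.trans (Real.exp_le_exp.2 ?_)
    have hc : (0 : ℝ) < s.card := by exact_mod_cast hne.card_pos
    have hMM : (((∑ _k ∈ s, (‖M - -M‖₊ / 2) ^ 2 : NNReal)) : ℝ) = s.card * M ^ 2 := by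
      simp only [Finset.sum_const, nsmul_eq_mul]
      push_cast
      rw [Real.norm_of_nonneg (by linarith)]
      ring
    rw [hMM, neg_div, neg_le_neg_iff, ← mul_assoc]
    gcongr
  have hsub : {ω | ε ≤ |∑ k ∈ s, f (ξ j k ω)|} ⊆
      {ω | ε ≤ ∑ k ∈ s, f (ξ j k ω)} ∪ {ω | ε ≤ ∑ k ∈ s, (fun b => -f b) (ξ j k ω)} := by
    intro ω hω
    rcases le_abs.1 (show ε ≤ |∑ k ∈ s, f (ξ j k ω)| from hω) with h | h
    · exact Or.inl h
    · exact Or.inr (by simpa [Finset.sum_neg_distrib] using h)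
  calc _ ≤ _ := measureReal_mono hsub (measure_ne_top _ _)
    _ ≤ _ := measureReal_union_le _ _
    _ ≤ _ := add_le_add (one f hf hf0)
      (one (fun b => -f b) (fun b => by rw [abs_neg]; exact hf b) (by linarith))
    _ = _ := (two_mul _).symm

/-- The selected row may change with `n`, but convergence in distribution sees only laws and all
rows have the same law, so the theorem for row 0 transfers. -/
theorem tendstoInDistribution_rows [IsProbabilityMeasure P] (hmeas : ∀ j k, Measurable (ξ j k))
    (hindep : iIndepFun (fun (a : ℕ × ℕ) => ξ a.1 a.2) P)
    (hlaw : ∀ j k, P.real {ω | ξ j k ω = true} = p) {f : Bool → ℝ}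
    (hf0 : p * f true + (1 - p) * f false = 0)
    (hf1 : p * f true ^ 2 + (1 - p) * f false ^ 2 = 1) (i : ℕ → ℕ) {m : ℕ → ℕ}
    (hm : Tendsto m atTop atTop) :
    TendstoInDistribution (fun n ω => (√(m n : ℝ))⁻¹ * ∑ k ∈ Finset.range (m n), f (ξ (i n) k ω))
      atTop (id : ℝ → ℝ) (fun _ => P) (gaussianReal 0 1) := by
  have hfm : Measurable f := by fun_prop
  have hid : ∀ j j' k k' : ℕ, IdentDistrib (ξ j k) (ξ j' k') P P := fun j j' k k' =>
    ⟨(hmeas j k).aemeasurable, (hmeas j' k').aemeasurable, by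
      have := Measure.isProbabilityMeasure_map (μ := P) (hmeas j k).aemeasurable
      have := Measure.isProbabilityMeasure_map (μ := P) (hmeas j' k').aemeasurable
      refine Measure.ext_of_singleton fun b => ?_
      rw [← measureReal_eq_measureReal_iff,
        map_measureReal_apply (hmeas j k) (measurableSet_singleton b),
        map_measureReal_apply (hmeas j' k') (measurableSet_singleton b)]
      exact (real_letter hmeas hlaw j k b).trans (real_letter hmeas hlaw j' k' b).symm⟩
  have hclt := tendstoInDistribution_inv_sqrt_mul_sum (P := P) (P' := gaussianReal 0 1)
    (X := fun k ω => f (ξ 0 k ω)) (Y := (id : ℝ → ℝ)) HasLaw.id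
    (by rw [integral_letter hmeas hlaw, hf0])
    (by
      have := integral_letter hmeas hlaw (fun b => f b ^ 2) 0 0
      rw [hf1] at this
      exact this)
    ((iIndepFun_row hindep 0).comp (fun _ => f) (fun _ => hfm))
    (fun k => (hid 0 0 k 0).comp hfm)
  refine ⟨fun n => ?_, aemeasurable_id, ?_⟩
  · exact ((Finset.measurable_sum _ fun k _ => hfm.comp (hmeas _ _)).const_mul _).aemeasurable
  · refine (hclt.tendsto.comp hm).congr fun n => ?_
    refine Subtype.ext ?_
    have hpi := IdentDistrib.pi (fun k => hid 0 (i n) k k) (iIndepFun_row hindep 0)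
      (iIndepFun_row hindep (i n))
    have hu : Measurable fun x : ℕ → Bool =>
        (√(m n : ℝ))⁻¹ * ∑ k ∈ Finset.range (m n), f (x k) := by fun_prop
    exact (hpi.comp hu).map_eq

end Sums

end RandomTrie

namespace RandomTrie

/-! ### Moments of the residual, and the pathwise comparison of times `D` and `m`. -/

section Constants

variable {p : ℝ}

/-- The expected number of steps to the right minus steps to the left, per unit of expected cost. -/
noncomputable def drift (p : ℝ) : ℝ := (p - (1 - p)) / Real.binEntropy p

/-- The step of a letter minus its prediction by the cost of the letter. -/
noncomputable def residual (p : ℝ) (b : Bool) : ℝ := step b - drift p * cost p b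

/-- The cost of a letter minus its expectation. -/
noncomputable def centeredCost (p : ℝ) (b : Bool) : ℝ := cost p b - Real.binEntropy p

/-- The variance of the residual of a random letter. -/
noncomputable def residualVar (p : ℝ) : ℝ :=
  p * (1 - p) * Real.log (p * (1 - p)) ^ 2 / Real.binEntropy p ^ 2

theorem mean_cost (p : ℝ) :
    p * cost p true + (1 - p) * cost p false = Real.binEntropy p := by
  simp [cost, letterProb, Real.binEntropy]

theorem mean_centeredCost (p : ℝ) :
    p * centeredCost p true + (1 - p) * centeredCost p false = 0 := by
  rw [centeredCost, centeredCost, ← mean_cost]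
  ring

theorem mean_residual (hp0 : 0 < p) (hp1 : p < 1) :
    p * residual p true + (1 - p) * residual p false = 0 := by
  have hH := (Real.binEntropy_pos hp0 hp1).ne'
  have h : p * residual p true + (1 - p) * residual p false =
      (p - (1 - p)) - drift p * (p * cost p true + (1 - p) * cost p false) := by
    simp only [residual, step]
    norm_num
    ring
  rw [h, mean_cost, drift, div_mul_cancel₀ _ hH, sub_self]

/-- A centred two-valued variable has variance `p * (1 - p)` times the squared gap between its
values; here the gap is `-log (p * (1 - p)) / H`. -/
theorem mean_residual_sq (hp0 : 0 < p) (hp1 : p < 1) :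
    p * residual p true ^ 2 + (1 - p) * residual p false ^ 2 = residualVar p := by
  have hH := (Real.binEntropy_pos hp0 hp1).ne'
  have hm := mean_residual hp0 hp1
  have h : (residual p true - residual p false) * Real.binEntropy p = -Real.log (p * (1 - p)) := by
    have h1 : (residual p true - residual p false) * Real.binEntropy p =
        2 * Real.binEntropy p - (p - (1 - p)) * (cost p true - cost p false) := by
      simp only [residual, step, drift]
      field_simp
      norm_num
      ring
    rw [h1, ← mean_cost, Real.log_mul hp0.ne' (by linarith : (1 - p) ≠ 0)]
    simp only [cost, letterProb]
    norm_num
    ring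
  have h2 : p * residual p true ^ 2 + (1 - p) * residual p false ^ 2 =
      p * (1 - p) * (residual p true - residual p false) ^ 2 := by
    linear_combination (p * residual p true + (1 - p) * residual p false) * hm
  rw [h2, residualVar, eq_div_iff (pow_ne_zero 2 hH), mul_assoc, ← mul_pow, h, neg_sq]

theorem residualVar_pos (hp0 : 0 < p) (hp1 : p < 1) : 0 < residualVar p := by
  have hq : 0 < 1 - p := by linarith
  have hH := Real.binEntropy_pos hp0 hp1
  have hlog : Real.log (p * (1 - p)) < 0 := Real.log_neg (by positivity) (by nlinarith)
  have := pow_pos (neg_pos.2 hlog) 2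
  rw [neg_sq] at this
  rw [residualVar]
  positivity

/-- A positive bound for the absolute value of a function of a letter. -/
def absBound (f : Bool → ℝ) : ℝ := |f true| + |f false| + 1

theorem absBound_pos (f : Bool → ℝ) : 0 < absBound f := by
  rw [absBound]
  positivity

theorem abs_le_absBound (f : Bool → ℝ) (b : Bool) : |f b| ≤ absBound f := by
  rw [absBound]
  cases b <;> linarith [abs_nonneg (f true), abs_nonneg (f false)]

/-- If the cost of the first `D` letters of `x` is close to `L` and the partial sums of the costs and
the residuals are regular, then the imbalance at `D` is close to its prediction at time `m`. -/
theorem abs_sum_step_sub_le (hp0 : 0 < p) (hp1 : p < 1) (x : ℕ → Bool) {D d₀ m : ℕ}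
    {L a b c w : ℝ} (haL : a < L)
    (hub : ∀ d ≤ d₀, d < D → ∑ k ∈ Finset.range d, cost p (x k) < L + a)
    (hlb : ∀ d ≤ d₀, ¬ d < D → L - a < ∑ k ∈ Finset.range d, cost p (x k))
    (hd₀ : L + a ≤ d₀ * minCost p)
    (hm : |m * Real.binEntropy p - L| ≤ Real.binEntropy p)
    (hcost : |∑ k ∈ Finset.range m, centeredCost p (x k)| < b)
    (hw : a + absBound (cost p) + Real.binEntropy p + b ≤ minCost p * w)
    (hres : ∀ d ≤ d₀, |(d : ℝ) - m| ≤ w →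
      |∑ k ∈ Finset.Ico (min d m) (max d m), residual p (x k)| < c) :
    |∑ k ∈ Finset.range D, step (x k) - drift p * L - ∑ k ∈ Finset.range m, residual p (x k)| ≤
      c + |drift p| * (a + absBound (cost p)) := by
  set W : ℕ → ℝ := fun d => ∑ k ∈ Finset.range d, cost p (x k) with hW
  -- Each letter costs at least `minCost p`, so by depth `d₀` the cost has reached `L + a`.
  have hDd : D ≤ d₀ := by
    by_contra! h
    have h1 := hub d₀ le_rfl h
    have h2 := card_mul_minCost_le (p := p) (Finset.range d₀) x
    rw [Finset.card_range] at h2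
    linarith
  -- Depth 0 has cost 0, which is below `L - a`.
  obtain ⟨e, rfl⟩ : ∃ e, D = e + 1 := by
    cases D with
    | zero =>
      have := hlb 0 (Nat.zero_le _) (lt_irrefl 0)
      simp only [Finset.range_zero, Finset.sum_empty] at this
      linarith
    | succ e => exact ⟨e, rfl⟩
  -- `hub` applies at `e` and `hlb` at `e + 1`; the overshoot is at most the cost of one letter.
  have hWD : |W (e + 1) - L| ≤ a + absBound (cost p) := by
    have h1 := hlb (e + 1) hDd (lt_irrefl _)
    have h2 := hub e (by omega) (Nat.lt_succ_self e)
    have h3 := (abs_le.1 (abs_le_absBound (cost p) (x e))).2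
    have h4 : W (e + 1) = W e + cost p (x e) := Finset.sum_range_succ _ _
    have h5 := absBound_pos (cost p)
    rw [abs_le]
    constructor
    · simp only [hW]
      linarith
    · rw [h4]
      simp only [hW]
      linarith
  have hWm : |W m - m * Real.binEntropy p| < b := by
    simp only [centeredCost] at hcost
    rw [Finset.sum_sub_distrib] at hcost
    simpa using hcost
  have hsplit : ∀ (f : ℕ → ℝ) (u v : ℕ),
      |∑ k ∈ Finset.range u, f k - ∑ k ∈ Finset.range v, f k| =
        |∑ k ∈ Finset.Ico (min u v) (max u v), f k| := by
    intro f u v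
    rcases le_total u v with h | h
    · rw [min_eq_left h, max_eq_right h, Finset.sum_Ico_eq_sub _ h, abs_sub_comm]
    · rw [min_eq_right h, max_eq_left h, Finset.sum_Ico_eq_sub _ h]
  have hcard : ∀ u v : ℕ, ((Finset.Ico (min u v) (max u v)).card : ℝ) = |(u : ℝ) - v| := by
    intro u v
    rw [Nat.card_Ico]
    rcases le_total u v with h | h
    · rw [min_eq_left h, max_eq_right h, Nat.cast_sub h, abs_sub_comm,
        abs_of_nonneg (sub_nonneg.2 (Nat.cast_le.2 h))]
    · rw [min_eq_right h, max_eq_left h, Nat.cast_sub h,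
        abs_of_nonneg (sub_nonneg.2 (Nat.cast_le.2 h))]
  -- The costs at `D` and `m` are both near `L`, and costs grow at least linearly in time, so the
  -- times are near as well.
  have hdist : |((e + 1 : ℕ) : ℝ) - m| ≤ w := by
    have h1 := card_mul_minCost_le (p := p) (Finset.Ico (min (e + 1) m) (max (e + 1) m)) x
    rw [hcard] at h1
    have h2 := (le_abs_self _).trans_eq (hsplit (fun k => cost p (x k)) (e + 1) m).symm
    have h3 : |W (e + 1) - W m| ≤ |W (e + 1) - L| + |m * Real.binEntropy p - L| +
        |W m - m * Real.binEntropy p| := by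
      have h4 := abs_sub_le (W (e + 1)) L (W m)
      have h5 := abs_sub_le (W m) (m * Real.binEntropy p) L
      rw [abs_sub_comm L] at h4
      linarith
    have h6 : |((e + 1 : ℕ) : ℝ) - m| * minCost p ≤ w * minCost p := by
      simp only [hW] at h3 hWD hWm
      linarith
    exact le_of_mul_le_mul_right h6 (minCost_pos hp0 hp1)
  have hfin := hres (e + 1) hDd hdist
  rw [← hsplit (fun k => residual p (x k))] at hfin
  have hstep : ∑ k ∈ Finset.range (e + 1), step (x k) =
      ∑ k ∈ Finset.range (e + 1), residual p (x k) + drift p * W (e + 1) := by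
    simp only [residual, Finset.sum_sub_distrib, hW, Finset.mul_sum]
    ring
  have hrew : ∑ k ∈ Finset.range (e + 1), step (x k) - drift p * L -
      ∑ k ∈ Finset.range m, residual p (x k) =
      (∑ k ∈ Finset.range (e + 1), residual p (x k) - ∑ k ∈ Finset.range m, residual p (x k)) +
        drift p * (W (e + 1) - L) := by
    rw [hstep]
    ring
  rw [hrew]
  refine (abs_add_le _ _).trans (add_le_add hfin.le ?_)
  rw [abs_mul]
  gcongr

end Constants

/-! ### Probability that the imbalance deviates from its prediction, and measurability. -/

section Deviation

variable {Ω : Type*} [MeasurableSpace Ω] {P : Measure Ω} {p : ℝ} {ξ : ℕ → ℕ → Ω → Bool}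

theorem real_le_of_subset_union [IsProbabilityMeasure P] {E B₀ B₄ : Set Ω} {B₁ B₂ B₃ : ℕ → Set Ω}
    {N : ℕ} {x₁ x₂ x₃ x₄ : ℝ}
    (hsub : E ⊆ (B₀ ∪ ⋃ d ∈ Finset.range N, (B₁ d ∪ B₂ d ∪ B₃ d)) ∪ B₄)
    (h₀ : P.real B₀ = 0) (h₁ : ∀ d, P.real (B₁ d) ≤ x₁) (h₂ : ∀ d, P.real (B₂ d) ≤ x₂)
    (h₃ : ∀ d, P.real (B₃ d) ≤ x₃) (h₄ : P.real B₄ ≤ x₄) :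
    P.real E ≤ N * (x₁ + x₂ + x₃) + x₄ := by
  have h : P.real (⋃ d ∈ Finset.range N, (B₁ d ∪ B₂ d ∪ B₃ d)) ≤ N * (x₁ + x₂ + x₃) := by
    refine (measureReal_biUnion_finset_le _ _).trans
      ((Finset.sum_le_card_nsmul _ _ (x₁ + x₂ + x₃) fun d _ => ?_).trans_eq ?_)
    · exact (measureReal_union_le _ _).trans (add_le_add ((measureReal_union_le _ _).trans
        (add_le_add (h₁ d) (h₂ d))) (h₃ d))
    · rw [nsmul_eq_mul, Finset.card_range]
  have h' := measureReal_union_le (μ := P) B₀ (⋃ d ∈ Finset.range N, (B₁ d ∪ B₂ d ∪ B₃ d))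
  have h'' := measureReal_union_le (μ := P)
    (B₀ ∪ ⋃ d ∈ Finset.range N, (B₁ d ∪ B₂ d ∪ B₃ d)) B₄
  have h''' := measureReal_mono hsub (measure_ne_top P _)
  linarith

/-- Since `D` is random, the hypotheses of `abs_sum_step_sub_le` are required at every depth up to
`d₀`, which costs the factor `d₀ + 1`. Outside the exceptional events the comparison is
deterministic. -/
theorem real_lt_abs_imbalance_sub_le [IsProbabilityMeasure P] (hp0 : 0 < p) (hp1 : p < 1)
    (hmeas : ∀ j k, Measurable (ξ j k))
    (hindep : iIndepFun (fun (a : ℕ × ℕ) => ξ a.1 a.2) P)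
    (hlaw : ∀ j k, P.real {ω | ξ j k ω = true} = p) (S : Finset ℕ) {i : ℕ} (hi : i ∈ S)
    {d₀ m : ℕ} {L a b c w : ℝ} (haL : a < L) (hm0 : 0 < m) (hb : 0 < b) (hc : 0 < c) (hw0 : 0 < w)
    (hd₀ : L + a ≤ d₀ * minCost p)
    (hm : |m * Real.binEntropy p - L| ≤ Real.binEntropy p)
    (hw : a + absBound (cost p) + Real.binEntropy p + b ≤ minCost p * w) :
    P.real {ω | c + |drift p| * (a + absBound (cost p)) <
      |((trie (fun j k => ξ j k ω) S).imbalance i : ℝ) - drift p * L -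
        ∑ k ∈ Finset.range m, residual p (ξ i k ω)|} ≤
      ((d₀ : ℝ) + 1) * (S.card * Real.exp (-(L + a)) +
        Real.exp (-((S.card - 1 : ℝ) * Real.exp (-(L - a)))) +
        2 * Real.exp (-(c ^ 2 / (2 * w * absBound (residual p) ^ 2)))) +
      2 * Real.exp (-(b ^ 2 / (2 * m * absBound (centeredCost p) ^ 2))) := by
  set B₀ : Set Ω := {ω | ¬ Function.Injective fun j k => ξ j k ω}
  have hB₀ : P.real B₀ = 0 := by
    rw [measureReal_def, ae_iff.1 (ae_injective_rows hp0 hp1 hmeas hindep hlaw)]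
    rfl
  set B₁ : ℕ → Set Ω := fun d => {ω | SharesPrefix (fun j k => ξ j k ω) S i d ∧
      L + a ≤ ∑ k ∈ Finset.range d, cost p (ξ i k ω)}
  set B₂ : ℕ → Set Ω := fun d => {ω | ¬ SharesPrefix (fun j k => ξ j k ω) S i d ∧
      ∑ k ∈ Finset.range d, cost p (ξ i k ω) ≤ L - a}
  set B₃ : ℕ → Set Ω := fun d => {ω | |(d : ℝ) - m| ≤ w ∧
      c ≤ |∑ k ∈ Finset.Ico (min d m) (max d m), residual p (ξ i k ω)|}
  set B₄ : Set Ω := {ω | b ≤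
      |∑ k ∈ Finset.range m, centeredCost p (ξ i k ω)|}
  have hB₃ : ∀ d, P.real (B₃ d) ≤
      2 * Real.exp (-(c ^ 2 / (2 * w * absBound (residual p) ^ 2))) := by
    intro d
    by_cases hd : |(d : ℝ) - m| ≤ w
    · refine (measureReal_mono (fun ω hω => hω.2) (measure_ne_top _ _)).trans
        (real_le_abs_sum_le hmeas hindep hlaw (absBound_pos _) (abs_le_absBound (residual p))
          (mean_residual hp0 hp1) i (Finset.Ico (min d m) (max d m)) hw0 ?_ hc)
      refine le_trans (le_of_eq ?_) hd
      rw [Nat.card_Ico]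
      rcases le_total d m with h | h
      · rw [min_eq_left h, max_eq_right h, Nat.cast_sub h, abs_sub_comm,
          abs_of_nonneg (sub_nonneg.2 (Nat.cast_le.2 h))]
      · rw [min_eq_right h, max_eq_left h, Nat.cast_sub h,
          abs_of_nonneg (sub_nonneg.2 (Nat.cast_le.2 h))]
    · have : B₃ d = ∅ := Set.eq_empty_of_forall_notMem fun ω hω => hd hω.1
      rw [this, measureReal_empty]
      positivity
  have hm0' : (0 : ℝ) < m := Nat.cast_pos.2 hm0
  have hB₄ : P.real B₄ ≤ 2 * Real.exp (-(b ^ 2 / (2 * m * absBound (centeredCost p) ^ 2))) :=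
    real_le_abs_sum_le hmeas hindep hlaw (absBound_pos _) (abs_le_absBound (centeredCost p))
      (mean_centeredCost p) i (Finset.range m) hm0' (by rw [Finset.card_range]) hb
  have hsub : {ω | c + |drift p| * (a + absBound (cost p)) <
      |((trie (fun j k => ξ j k ω) S).imbalance i : ℝ) - drift p * L -
        ∑ k ∈ Finset.range m, residual p (ξ i k ω)|} ⊆
      (B₀ ∪ ⋃ d ∈ Finset.range (d₀ + 1), (B₁ d ∪ B₂ d ∪ B₃ d)) ∪ B₄ := by
    intro ω hω
    by_contra hnot
    simp only [Set.mem_union, Set.mem_iUnion, not_or, not_exists, Finset.mem_range] at hnot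
    obtain ⟨⟨h0, h123⟩, h4⟩ := hnot
    obtain ⟨D, hD, hs⟩ := exists_imbalance_trie
      ((not_not.1 h0 : Function.Injective fun j k => ξ j k ω).injOn (s := (S : Set ℕ))) hi
    simp only [Set.mem_ofPred_eq, ← not_le] at hω
    refine hω ?_
    rw [hD]
    refine abs_sum_step_sub_le hp0 hp1 (fun k => ξ i k ω) haL (fun d hd hdD => ?_)
      (fun d hd hdD => ?_) hd₀ hm (not_le.1 h4) hw (fun d hd hdm => ?_)
    · by_contra! h
      exact (h123 d (by omega)).1.1 ⟨(hs d).2 hdD, h⟩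
    · by_contra! h
      exact (h123 d (by omega)).1.2 ⟨fun h' => hdD ((hs d).1 h'), h⟩
    · by_contra! h
      exact (h123 d (by omega)).2 ⟨hdm, h⟩
  have hfin := real_le_of_subset_union hsub hB₀
    (fun d => real_sharesPrefix_and_le hp0 hp1 hmeas hindep hlaw S i d _)
    (fun d => real_not_sharesPrefix_and_le hp0 hp1 hmeas hindep hlaw S hi d _) hB₃ hB₄
  rwa [Nat.cast_succ] at hfin

theorem measurableSet_sharesPrefix (hmeas : ∀ j k, Measurable (ξ j k)) (S : Finset ℕ) (i d : ℕ) :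
    MeasurableSet {ω | SharesPrefix (fun j k => ξ j k ω) S i d} := by
  have : {ω | SharesPrefix (fun j k => ξ j k ω) S i d} =
      ⋃ j ∈ S.erase i, ⋂ a ∈ Finset.range d, {ω | ξ j a ω = ξ i a ω} := by
    ext ω
    simp only [SharesPrefix, Set.mem_iUnion, Set.mem_iInter, Finset.mem_erase, Finset.mem_range]
    exact exists_congr fun j => by
      constructor
      · rintro ⟨h1, h2, h3⟩
        exact ⟨⟨h2, h1⟩, h3⟩
      · rintro ⟨⟨h2, h1⟩, h3⟩
        exact ⟨h1, h2, h3⟩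
  rw [this]
  exact Finset.measurableSet_biUnion _ fun j _ => Finset.measurableSet_biInter _ fun a _ =>
    measurableSet_eq_fun (hmeas j a) (hmeas i a)

-- Almost surely the imbalance is the limit of truncated step sums, in which the `k`th step counts
-- when the prefix of length `k` is shared.
open Classical in
theorem aemeasurable_imbalance [IsProbabilityMeasure P] (hp0 : 0 < p) (hp1 : p < 1)
    (hmeas : ∀ j k, Measurable (ξ j k))
    (hindep : iIndepFun (fun (a : ℕ × ℕ) => ξ a.1 a.2) P)
    (hlaw : ∀ j k, P.real {ω | ξ j k ω = true} = p) (S : Finset ℕ) {i : ℕ} (hi : i ∈ S) :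
    AEMeasurable (fun ω => ((trie (fun j k => ξ j k ω) S).imbalance i : ℝ)) P := by
  have hstep : Measurable step := by fun_prop
  refine aemeasurable_of_tendsto_metrizable_ae atTop (f := fun N ω => ∑ k ∈ Finset.range N,
    {ω | SharesPrefix (fun j k => ξ j k ω) S i k}.indicator (fun ω => step (ξ i k ω)) ω)
    (fun N => (Finset.measurable_sum _ fun k _ => (hstep.comp (hmeas i k)).indicator
      (measurableSet_sharesPrefix hmeas S i k)).aemeasurable) ?_
  filter_upwards [ae_injective_rows hp0 hp1 hmeas hindep hlaw] with ω hω
  obtain ⟨D, hD, hs⟩ := exists_imbalance_trie (hω.injOn (s := (S : Set ℕ))) hi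
  refine tendsto_const_nhds.congr' ?_
  filter_upwards [eventually_ge_atTop D] with N hN
  rw [hD]
  simp only [Set.indicator_apply]
  have hiff : ∀ k, ω ∈ {ω | SharesPrefix (fun j k => ξ j k ω) S i k} ↔ k < D := hs
  simp only [hiff]
  rw [← Finset.sum_filter]
  refine Finset.sum_congr ?_ fun _ _ => rfl
  ext k
  simp only [Finset.mem_range, Finset.mem_filter]
  omega

end Deviation

end RandomTrie

namespace RandomTrie

/-! ### Choice of scales, and negligibility of the error. -/

section Limit

variable {Ω : Type*} [MeasurableSpace Ω] {P : Measure Ω} {p : ℝ} {ξ : ℕ → ℕ → Ω → Bool}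

theorem tendsto_pow_add_mul_exp_neg (A B : ℝ) (k : ℕ) {β : ℝ} (hβ : 0 < β) :
    Tendsto (fun s : ℝ => (A * s ^ k + B) * Real.exp (-(β * s))) atTop (nhds 0) := by
  have h : ∀ j : ℕ, Tendsto (fun s : ℝ => s ^ j * Real.exp (-(β * s))) atTop (nhds 0) := by
    intro j
    have h1 := (Real.tendsto_pow_mul_exp_neg_atTop_nhds_zero j).comp
      (tendsto_id.const_mul_atTop hβ)
    have h2 := h1.const_mul ((β ^ j)⁻¹)
    rw [mul_zero] at h2
    refine h2.congr fun s => ?_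
    simp only [Function.comp_apply, id]
    rw [mul_pow]
    field_simp
  have h3 := ((h k).const_mul A).add ((h 0).const_mul B)
  rw [mul_zero, mul_zero, add_zero] at h3
  exact h3.congr fun s => by ring

/-- With `L = s ^ 6`, the target precision is `s ^ 3`. The cost at time `m` fluctuates on the scale
`s ^ 3`, well within `b = s ^ 4`, so `D` and `m` differ by `O(s ^ 4)`. Residuals over such a window
fluctuate only on the scale `s ^ 2`, well within `c = ε * s ^ 3`. Every exceptional probability is
then at most a constant times `exp (-(β * s))`, which beats the `O(s ^ 6)` depths. -/
theorem exists_real_le_abs_imbalance_sub_le [IsProbabilityMeasure P] (hp0 : 0 < p) (hp1 : p < 1)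
    (hmeas : ∀ j k, Measurable (ξ j k))
    (hindep : iIndepFun (fun (a : ℕ × ℕ) => ξ a.1 a.2) P)
    (hlaw : ∀ j k, P.real {ω | ξ j k ω = true} = p) {η : ℝ} (hη : 0 < η) :
    ∃ s₀ A B β : ℝ, 0 < β ∧ ∀ (S : Finset ℕ), ∀ i ∈ S, ∀ s : ℝ, 2 ≤ S.card → s₀ ≤ s →
      s ^ 6 = Real.log S.card →
      P.real {ω | η * s ^ 3 ≤ |((trie (fun j k => ξ j k ω) S).imbalance i : ℝ) - drift p * s ^ 6 -
        ∑ k ∈ Finset.range ⌊s ^ 6 / Real.binEntropy p⌋₊, residual p (ξ i k ω)|} ≤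
        (A * s ^ 6 + B) * Real.exp (-(β * s)) := by
  set H := Real.binEntropy p
  have hH : 0 < H := Real.binEntropy_pos hp0 hp1
  set μ := minCost p
  have hμ : 0 < μ := minCost_pos hp0 hp1
  set C := absBound (cost p)
  have hC : 0 < C := absBound_pos _
  set M := absBound (residual p)
  have hM : 0 < M := absBound_pos _
  set M' := absBound (centeredCost p)
  have hM' : 0 < M' := absBound_pos _
  set κ := |drift p|
  have hκ : 0 ≤ κ := abs_nonneg _
  -- With `a = c = ε * s ^ 3` the error is `ε * (1 + κ) * s ^ 3 + κ * C`; half of `η * s ^ 3` is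
  -- left for `κ * C`.
  set ε := η / (2 * (1 + κ)) with hε_def
  have hε : 0 < ε := by positivity
  have hεη : ε * (1 + κ) = η / 2 := by
    rw [hε_def]
    field_simp
  -- The three rates serve the two prefix events, the residual window and the cost at time `m`.
  set β := min (ε / 2) (min (ε ^ 2 / (2 * (4 / μ) * M ^ 2)) (H / (2 * M' ^ 2)))
  have hβ1 : β ≤ ε / 2 := min_le_left _ _
  have hβ2 : β ≤ ε ^ 2 / (2 * (4 / μ) * M ^ 2) := (min_le_right _ _).trans (min_le_left _ _)
  have hβ3 : β ≤ H / (2 * M' ^ 2) := (min_le_right _ _).trans (min_le_right _ _)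
  have hβ : 0 < β := lt_min (by positivity) (lt_min (by positivity) (by positivity))
  refine ⟨1 + ε + C + H + 2 * κ * C / η, 8 / μ, 10, β, hβ, fun S i hi s hS hs hlog => ?_⟩
  have h0 : 0 ≤ 2 * κ * C / η := by positivity
  have hs1 : 1 ≤ s := by linarith
  have hspos : 0 < s := by linarith
  have hs2 : s ≤ s ^ 2 := le_self_pow₀ hs1 (by norm_num)
  have hs3 : s ≤ s ^ 3 := le_self_pow₀ hs1 (by norm_num)
  have hs4 : s ≤ s ^ 4 := le_self_pow₀ hs1 (by norm_num)
  have hs6 : s ≤ s ^ 6 := le_self_pow₀ hs1 (by norm_num)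
  have hεs4 : ε * s ^ 3 ≤ s ^ 4 := by
    rw [pow_succ' s 3]
    gcongr
    linarith
  have hεs6 : ε * s ^ 3 < s ^ 6 := by
    have h1 : ε < s ^ 3 := by linarith
    calc ε * s ^ 3 < s ^ 3 * s ^ 3 := by gcongr
      _ = s ^ 6 := by ring
  have hκC : κ * C < η / 2 * s ^ 3 := by
    have h1 : 2 * κ * C / η < s ^ 3 := by linarith
    rw [div_lt_iff₀ hη] at h1
    linarith
  set m := ⌊s ^ 6 / H⌋₊
  have hmle : (m : ℝ) ≤ s ^ 6 / H := Nat.floor_le (by positivity)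
  have hm0 : 0 < m := Nat.floor_pos.2 ((one_le_div hH).2 (by linarith))
  have hm0' : (0 : ℝ) < m := Nat.cast_pos.2 hm0
  have hmH : |m * H - s ^ 6| ≤ H := by
    have h1 := Nat.lt_floor_add_one (s ^ 6 / H)
    rw [div_lt_iff₀ hH] at h1
    rw [le_div_iff₀ hH] at hmle
    rw [abs_le]
    constructor <;> linarith
  set d₀ := ⌈2 * s ^ 6 / μ⌉₊
  have hd₀ : s ^ 6 + ε * s ^ 3 ≤ d₀ * μ := by
    have h1 := Nat.le_ceil (2 * s ^ 6 / μ)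
    rw [div_le_iff₀ hμ] at h1
    linarith
  have hd₀' : (d₀ : ℝ) + 1 ≤ 2 * s ^ 6 / μ + 2 := by
    have h1 := Nat.ceil_lt_add_one (show 0 ≤ 2 * s ^ 6 / μ by positivity)
    linarith
  have hw : ε * s ^ 3 + C + H + s ^ 4 ≤ μ * (4 / μ * s ^ 4) := by
    have h1 : μ * (4 / μ * s ^ 4) = 4 * s ^ 4 := by field_simp
    rw [h1]
    linarith
  have hmain := real_lt_abs_imbalance_sub_le hp0 hp1 hmeas hindep hlaw S hi hεs6 hm0
    (show 0 < s ^ 4 by positivity) (show 0 < ε * s ^ 3 by positivity)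
    (show 0 < 4 / μ * s ^ 4 by positivity) hd₀ hmH hw
  have hcard : (S.card : ℝ) = Real.exp (s ^ 6) := by
    rw [hlog, Real.exp_log (by exact_mod_cast (by omega : 0 < S.card))]
  have hcard2 : (2 : ℝ) ≤ S.card := by exact_mod_cast hS
  have e1 : S.card * Real.exp (-(s ^ 6 + ε * s ^ 3)) ≤ Real.exp (-(β * s)) := by
    rw [hcard, ← Real.exp_add]
    refine Real.exp_le_exp.2 ?_
    have : β * s ≤ ε * s ^ 3 := by
      gcongr
      linarith
    linarith
  have e2 : Real.exp (-((S.card - 1 : ℝ) * Real.exp (-(s ^ 6 - ε * s ^ 3)))) ≤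
      Real.exp (-(β * s)) := by
    refine Real.exp_le_exp.2 (neg_le_neg ?_)
    calc β * s ≤ ε / 2 * s ^ 3 := by gcongr
      _ ≤ 1 / 2 * Real.exp (ε * s ^ 3) := by
        have := Real.add_one_le_exp (ε * s ^ 3)
        linarith
      _ = (S.card / 2 : ℝ) * Real.exp (-(s ^ 6 - ε * s ^ 3)) := by
        have : ε * s ^ 3 = s ^ 6 + -(s ^ 6 - ε * s ^ 3) := by ring
        rw [hcard, this, Real.exp_add, ← this]
        ring
      _ ≤ _ := by
        gcongr
        linarith
  have e3 : Real.exp (-((ε * s ^ 3) ^ 2 / (2 * (4 / μ * s ^ 4) * M ^ 2))) ≤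
      Real.exp (-(β * s)) := by
    refine Real.exp_le_exp.2 (neg_le_neg ?_)
    calc β * s ≤ ε ^ 2 / (2 * (4 / μ) * M ^ 2) * s ^ 2 := by gcongr
      _ = _ := by field_simp
  have e4 : Real.exp (-((s ^ 4) ^ 2 / (2 * m * M' ^ 2))) ≤ Real.exp (-(β * s)) := by
    refine Real.exp_le_exp.2 (neg_le_neg ?_)
    calc β * s ≤ H / (2 * M' ^ 2) * s ^ 2 := by gcongr
      _ = (s ^ 4) ^ 2 / (2 * (s ^ 6 / H) * M' ^ 2) := by field_simp
      _ ≤ _ := by gcongr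
  have hsub : {ω | η * s ^ 3 ≤ |((trie (fun j k => ξ j k ω) S).imbalance i : ℝ) -
        drift p * s ^ 6 - ∑ k ∈ Finset.range m, residual p (ξ i k ω)|} ⊆
      {ω | ε * s ^ 3 + κ * (ε * s ^ 3 + C) < |((trie (fun j k => ξ j k ω) S).imbalance i : ℝ) -
        drift p * s ^ 6 - ∑ k ∈ Finset.range m, residual p (ξ i k ω)|} := by
    intro ω hω
    rw [Set.mem_ofPred_eq] at hω ⊢
    refine lt_of_lt_of_le ?_ hω
    have : ε * s ^ 3 + κ * (ε * s ^ 3 + C) = ε * (1 + κ) * s ^ 3 + κ * C := by ring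
    rw [this, hεη]
    linarith
  refine (measureReal_mono hsub (measure_ne_top _ _)).trans (hmain.trans ?_)
  have hexp := Real.exp_pos (-(β * s))
  calc _ ≤ (2 * s ^ 6 / μ + 2) * (4 * Real.exp (-(β * s))) + 2 * Real.exp (-(β * s)) := by
        refine add_le_add (mul_le_mul hd₀' ?_ ?_ ?_) (mul_le_mul_of_nonneg_left e4 zero_le_two)
        · linarith
        · exact add_nonneg (add_nonneg (mul_nonneg (Nat.cast_nonneg _) (Real.exp_pos _).le)
            (Real.exp_pos _).le) (mul_nonneg zero_le_two (Real.exp_pos _).le)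
        · positivity
    _ = _ := by ring

theorem tendsto_real_le_abs_imbalance_sub [IsProbabilityMeasure P] (hp0 : 0 < p) (hp1 : p < 1)
    (hmeas : ∀ j k, Measurable (ξ j k))
    (hindep : iIndepFun (fun (a : ℕ × ℕ) => ξ a.1 a.2) P)
    (hlaw : ∀ j k, P.real {ω | ξ j k ω = true} = p)
    {i : ℕ → ℕ} (hi : ∀ n, 1 ≤ n → i n < n) {η : ℝ} (hη : 0 < η) :
    Tendsto (fun n : ℕ => P.real {ω | η * √(Real.log n) ≤
      |((trie (fun j k => ξ j k ω) (Finset.range n)).imbalance (i n) : ℝ) -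
        drift p * Real.log n -
        ∑ k ∈ Finset.range ⌊Real.log n / Real.binEntropy p⌋₊, residual p (ξ (i n) k ω)|})
      atTop (nhds 0) := by
  obtain ⟨s₀, A, B, β, hβ, h⟩ :=
    exists_real_le_abs_imbalance_sub_le hp0 hp1 hmeas hindep hlaw hη
  have hs : Tendsto (fun n : ℕ => Real.log n ^ (1 / 6 : ℝ)) atTop atTop :=
    (tendsto_rpow_atTop (by norm_num)).comp
      (Real.tendsto_log_atTop.comp tendsto_natCast_atTop_atTop)
  refine squeeze_zero' (Eventually.of_forall fun n => measureReal_nonneg) ?_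
    ((tendsto_pow_add_mul_exp_neg A B 6 hβ).comp hs)
  filter_upwards [hs.eventually_ge_atTop s₀, eventually_ge_atTop 2] with n hn hn2
  have hlog : 0 ≤ Real.log n := Real.log_natCast_nonneg n
  have h6 : (Real.log n ^ (1 / 6 : ℝ)) ^ 6 = Real.log n := by
    rw [← Real.rpow_natCast, ← Real.rpow_mul hlog]
    norm_num
  have h3 : (Real.log n ^ (1 / 6 : ℝ)) ^ 3 = √(Real.log n) := by
    rw [← Real.rpow_natCast, ← Real.rpow_mul hlog, Real.sqrt_eq_rpow]
    norm_num
  have := h (Finset.range n) (i n) (Finset.mem_range.2 (hi n (by omega))) _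
    (by simpa using hn2) hn (by simpa using h6)
  rw [h3, h6] at this
  simpa only [Function.comp_apply, h6] using this

theorem trie_empty {ι : Type*} (x : ι → ℕ → Bool) : trie x ∅ = .empty := by
  have h : ∃ t, IsTrie x 0 ∅ t := ⟨_, .empty 0⟩
  rw [trie, dif_pos h]
  exact h.choose_spec.unique (.empty 0)

end Limit

end RandomTrie

/-! ### Assembly by Slutsky's theorem. -/

open RandomTrie in
/-- `ξ j k` is the letter at position `k` of the `j`-th random string; the trie of size `n` is built
from the strings with indices `0, …, n - 1`, and `i n` is the index of the selected string in it. -/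
theorem mainTheorem11 {Ω : Type*} [MeasurableSpace Ω] (P : Measure Ω) [IsProbabilityMeasure P]
    (p : ℝ) (hp0 : 0 < p) (hp1 : p < 1)
    (ξ : ℕ → ℕ → Ω → Bool) (hmeas : ∀ j k, Measurable (ξ j k))
    (hindep : iIndepFun (fun (a : ℕ × ℕ) => ξ a.1 a.2) P)
    (hlaw : ∀ j k, P.real {ω | ξ j k ω = true} = p)
    (i : ℕ → ℕ) (hi : ∀ n, 1 ≤ n → i n < n) :
    RandomTrie.AsN P
      (fun n ω =>
        (((RandomTrie.trie (fun j k => ξ j k ω) (Finset.range n)).imbalance (i n) : ℤ) : ℝ))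
      (fun n => (p - (1 - p)) / Real.binEntropy p * Real.log n)
      (fun n => p * (1 - p) * Real.log (p * (1 - p)) ^ 2 / Real.binEntropy p ^ 3 * Real.log n) := by
  have hH := Real.binEntropy_pos hp0 hp1
  have hσ := residualVar_pos hp0 hp1
  have hlim : Tendsto (fun n : ℕ => Real.log n) atTop atTop :=
    Real.tendsto_log_atTop.comp tendsto_natCast_atTop_atTop
  set v : ℕ → ℝ := fun n =>
    p * (1 - p) * Real.log (p * (1 - p)) ^ 2 / Real.binEntropy p ^ 3 * Real.log n
  have hv : ∀ n, v n = residualVar p / Real.binEntropy p * Real.log n := fun n => by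
    simp only [v, residualVar]
    field_simp
  refine ⟨?_, ?_⟩
  · filter_upwards [hlim.eventually_gt_atTop 0] with n hn
    rw [hv]
    positivity
  have hmeasZ : ∀ n, AEMeasurable (fun ω =>
      (((trie (fun j k => ξ j k ω) (Finset.range n)).imbalance (i n) : ℤ) : ℝ)) P := by
    intro n
    -- For `n = 0` the index `i 0` is unconstrained, but the trie is empty and the imbalance
    -- constant.
    rcases Nat.eq_zero_or_pos n with rfl | hn
    · simp only [Finset.range_zero, trie_empty]
      exact aemeasurable_const
    · exact aemeasurable_imbalance hp0 hp1 hmeas hindep hlaw _ (Finset.mem_range.2 (hi n hn))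
  set m : ℕ → ℕ := fun n => ⌊Real.log n / Real.binEntropy p⌋₊
  have hm : Tendsto m atTop atTop :=
    tendsto_nat_floor_atTop.comp (hlim.atTop_div_const hH)
  have hclt := tendstoInDistribution_rows hmeas hindep hlaw
    (f := fun b => residual p b / √(residualVar p))
    (by
      have := mean_residual hp0 hp1
      rw [mul_div_assoc', mul_div_assoc', ← add_div, this, zero_div])
    (by
      rw [div_pow, div_pow, Real.sq_sqrt hσ.le, mul_div_assoc', mul_div_assoc', ← add_div,
        mean_residual_sq hp0 hp1, div_self hσ.ne']) i hm
  -- This is the square root of `m n / (log n / H)`, so only the rounding in the floor matters.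
  have hratio : Tendsto (fun n => √(m n : ℝ) * √(residualVar p) / √(v n)) atTop (nhds 1) := by
    have h1 := (tendsto_nat_floor_div_atTop (R := ℝ)).comp (hlim.atTop_div_const hH)
    have h2 := (Real.continuous_sqrt.tendsto 1).comp h1
    rw [Real.sqrt_one] at h2
    refine h2.congr' ?_
    filter_upwards [hlim.eventually_gt_atTop 0] with n hn
    rw [← Real.sqrt_mul (Nat.cast_nonneg _), ← Real.sqrt_div' _ (by rw [hv]; positivity), hv]
    simp only [Function.comp_apply]
    congr 1
    field_simp
    rfl
  have hX : TendstoInDistribution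
      (fun n ω => (∑ k ∈ Finset.range (m n), residual p (ξ (i n) k ω)) / √(v n)) atTop
      (id : ℝ → ℝ) (fun _ => P) (gaussianReal 0 1) := by
    have h1 := hclt.continuous_comp_prodMk_of_tendstoInMeasure_const
      (g := fun x : ℝ × ℝ => x.1 * x.2) (by fun_prop)
      (Y := fun n _ => √(m n : ℝ) * √(residualVar p) / √(v n)) (c := 1)
      (tendstoInMeasure_of_tendsto_ae (fun n => aestronglyMeasurable_const)
        (ae_of_all _ fun _ => hratio)) (fun n => aemeasurable_const)
    refine h1.congr (fun n => ae_of_all _ fun ω => ?_) (ae_of_all _ fun x => mul_one x)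
    simp only
    rw [← Finset.sum_div]
    rcases Nat.eq_zero_or_pos (m n) with h | h
    · simp [h]
    · have hm0 : √(m n : ℝ) ≠ 0 := (Real.sqrt_pos.2 (Nat.cast_pos.2 h)).ne'
      have hσ0 : √(residualVar p) ≠ 0 := (Real.sqrt_pos.2 hσ).ne'
      field_simp
  -- What remains is that the imbalance, after centring, differs from the residual sum by `o(√(log
  -- n))` in probability.
  refine tendstoInDistribution_of_tendstoInMeasure_sub _ _ hX ?_
    (fun n => ((hmeasZ n).sub_const _).div_const _)
  rw [tendstoInMeasure_iff_measureReal_norm]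
  intro δ hδ
  have hc : 0 < √(residualVar p / Real.binEntropy p) := Real.sqrt_pos.2 (by positivity)
  refine (tendsto_real_le_abs_imbalance_sub hp0 hp1 hmeas hindep hlaw hi
    (mul_pos hδ hc)).congr' ?_
  filter_upwards [hlim.eventually_gt_atTop 0] with n hn
  congr 1
  ext ω
  have hvn : √(v n) = √(residualVar p / Real.binEntropy p) * √(Real.log n) := by
    rw [hv, Real.sqrt_mul (by positivity)]
  have hvpos : 0 < √(v n) := by
    rw [hvn]
    exact mul_pos hc (Real.sqrt_pos.2 hn)
  simp only [Set.mem_ofPred_eq, Pi.sub_apply, Pi.zero_apply, sub_zero]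
  rw [← sub_div, norm_div, Real.norm_of_nonneg hvpos.le, le_div_iff₀ hvpos, hvn, mul_assoc,
    Real.norm_eq_abs]
  rfl
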